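/- Let $\mathbb D$ be the open unit disc and let $H^2(\mathbb D)$ be the Hardy space of all analytic functions $f(z)=\sum_{n\ge 0} a_n z^n$ on $\mathbb D$ with $\|f\|=\big(\sum_{n\ge 0}|a_n|^2\big)^{1/2}<\infty$. Let $\psi$ be an inner function, that is, $\psi$ is analytic on $\mathbb D$ with $|\psi|\le 1$ there, and for almost every $\theta$ the radial limit $\lim_{r\to1^-}\psi(re^{i\theta})$ exists and has modulus $1$. Let $a,b\in\mathbb C$ with $|b|<1$ and $|a|+|b|\le 1$, and put $\varphi(z)=az\psi(z)+b$ and $\sigma(z)=az+b$ for $z\in\mathbb D$. Then $\varphi$ and $\sigma$ map $\mathbb D$ into $\mathbb D$, the composition operators $C_\varphi f=f\circ\varphi$ and $C_\sigma f=f\circ\sigma$ are bounded linear operators on $H^2(\mathbb D)$, and their operator norms satisfy $$ \|C_\varphi\|=\|C_\sigma\|=\sqrt{\frac{2}{1+|a|^2-|b|^2+\sqrt{(1-|a|^2+|b|^2)^2-4|b|^2}}}. $$ -/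

import Mathlib

open Filter Topology MeasureTheory
open scoped Complex.UnitDisc

/-- The coefficient space `ℓ²(ℕ)` of square-summable complex sequences. -/
abbrev EllTwo : Type := lp (fun _ : ℕ => ℂ) 2

theorem powerSeries_coeff_unique {f : 𝔻 → ℂ} {a b : ℕ → ℂ}
    (ha : ∀ z : 𝔻, HasSum (fun n => a n * (z : ℂ) ^ n) (f z))
    (hb : ∀ z : 𝔻, HasSum (fun n => b n * (z : ℂ) ^ n) (f z)) : a = b := by
  have key : ∀ c : ℕ → ℂ, (∀ z : 𝔻, HasSum (fun n => c n * (z : ℂ) ^ n) 0) → c = 0 := by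
    intro c hc
    have h : HasFPowerSeriesAt (fun _ : ℂ => (0 : ℂ)) (FormalMultilinearSeries.ofScalars ℂ c) 0 := by
      rw [hasFPowerSeriesAt_iff]
      filter_upwards [Metric.ball_mem_nhds (0 : ℂ) one_pos] with z hz
      have := hc (Complex.UnitDisc.mk z (by simpa using hz))
      simpa [mul_comm, FormalMultilinearSeries.coeff_ofScalars] using this
    have h0 := h.eq_zero
    funext n
    have := congrArg (fun p : FormalMultilinearSeries ℂ ℂ ℂ => p.coeff n) h0
    have h1 : c n = 0 := by
      simp only [FormalMultilinearSeries.coeff_ofScalars] at this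
      exact this
    exact h1
  have := key (a - b) (fun z => by
    simpa [sub_mul] using (ha z).sub (hb z))
  exact sub_eq_zero.mp this

/-- Functions on the unit disc that are sums of power series with square-summable coefficients. -/
def hardySubmodule : Submodule ℂ (𝔻 → ℂ) where
  carrier := {f | ∃ a : EllTwo, ∀ z : 𝔻, HasSum (fun n => a n * (z : ℂ) ^ n) (f z)}
  zero_mem' := ⟨0, fun z => by simp [hasSum_zero]⟩
  add_mem' := by
    rintro f g ⟨a, ha⟩ ⟨b, hb⟩
    exact ⟨a + b, fun z => by simpa [add_mul] using (ha z).add (hb z)⟩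
  smul_mem' := by
    rintro c f ⟨a, ha⟩
    exact ⟨c • a, fun z => by simpa [mul_assoc] using (ha z).mul_left c⟩

/-- The Hardy space `H²(𝔻)`: all `f(z) = ∑ aₙ zⁿ` on the unit disc with `∑ |aₙ|² < ∞`. It is a type
of its own so that its topology comes from the Hardy norm below. -/
def HardySpace : Type := hardySubmodule

namespace HardySpace

noncomputable instance : AddCommGroup HardySpace := inferInstanceAs (AddCommGroup hardySubmodule)

noncomputable instance : Module ℂ HardySpace := inferInstanceAs (Module ℂ hardySubmodule)

instance : CoeFun HardySpace (fun _ => 𝔻 → ℂ) := ⟨fun f => f.1⟩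

theorem exists_coeff (f : HardySpace) :
    ∃ a : EllTwo, ∀ z : 𝔻, HasSum (fun n => a n * (z : ℂ) ^ n) (f z) := f.2

/-- The sequence of power series coefficients of `f`. -/
noncomputable def coeff (f : HardySpace) : EllTwo := f.exists_coeff.choose

theorem hasSum_coeff (f : HardySpace) (z : 𝔻) :
    HasSum (fun n => coeff f n * (z : ℂ) ^ n) (f z) := f.exists_coeff.choose_spec z

theorem coeff_eq (f : HardySpace) (a : EllTwo)
    (ha : ∀ z : 𝔻, HasSum (fun n => a n * (z : ℂ) ^ n) (f z)) : coeff f = a :=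
  Subtype.ext (powerSeries_coeff_unique f.hasSum_coeff ha)

/-- The coefficient map `H²(𝔻) → ℓ²(ℕ)` as a linear map. -/
noncomputable def coeffLinear : HardySpace →ₗ[ℂ] EllTwo where
  toFun := coeff
  map_add' f g := coeff_eq _ _ fun z => by
    have h := (f.hasSum_coeff z).add (g.hasSum_coeff z)
    change HasSum _ (f z + g z)
    simpa [add_mul] using h
  map_smul' c f := coeff_eq _ _ fun z => by
    have h := (f.hasSum_coeff z).mul_left c
    change HasSum _ (c * f z)
    simpa [mul_assoc] using h

theorem coeffLinear_injective : Function.Injective coeffLinear := by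
  intro f g h
  apply Subtype.ext
  funext z
  have h' : coeff f = coeff g := h
  have hf := f.hasSum_coeff z
  rw [h'] at hf
  exact hf.unique (g.hasSum_coeff z)

/-- The Hardy norm: the `ℓ²` norm of the coefficient sequence. -/
noncomputable instance : NormedAddCommGroup HardySpace :=
  NormedAddCommGroup.induced HardySpace EllTwo coeffLinear coeffLinear_injective

noncomputable instance : NormedSpace ℂ HardySpace :=
  NormedSpace.induced ℂ HardySpace EllTwo coeffLinear

theorem norm_eq (f : HardySpace) : ‖f‖ = Real.sqrt (∑' n, ‖coeff f n‖ ^ 2) := by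
  change ‖coeff f‖ = _
  rw [lp.norm_eq_tsum_rpow (by norm_num), Real.sqrt_eq_rpow]
  norm_num

end HardySpace

/-- `ψ` is an inner function: it is analytic and bounded by `1` on the open unit disc, and at almost
every point of the unit circle its radial limit exists and has modulus `1`. Only the values of `ψ`
on the open unit disc matter. -/
def IsInnerFunction (ψ : ℂ → ℂ) : Prop :=
  DifferentiableOn ℂ ψ (Metric.ball 0 1) ∧
  (∀ z ∈ Metric.ball (0 : ℂ) 1, ‖ψ z‖ ≤ 1) ∧
  ∀ᵐ θ : ℝ, ∃ w : ℂ, ‖w‖ = 1 ∧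
    Tendsto (fun r : ℝ => ψ (r * Complex.exp (θ * Complex.I))) (𝓝[<] 1) (𝓝 w)

/-- `C` is the (bounded) composition operator `f ↦ f ∘ φ` on the Hardy space. -/
def IsCompositionOperator (φ : 𝔻 → 𝔻) (C : HardySpace →L[ℂ] HardySpace) : Prop :=
  ∀ (f : HardySpace) (z : 𝔻), C f z = f (φ z)

/-! Put `τ z = z ψ z`. Then `φ = σ ∘ τ`, so `Cφ = Cτ ∘ Cσ`. The function `τ` is inner and vanishes
at the origin, and its powers are orthonormal in `H²`: on the boundary `τ ^ (n + d) * conj (τ ^ n) =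
τ ^ d`, whose mean is `τ 0 ^ d = 0 ^ d` (`orthonormal_powCoeff`). Hence `Cτ` is an isometry and
`‖Cφ‖ = ‖Cσ‖`.

It remains to compute the norm for the affine symbol. Write `A = ‖a‖`, `B = ‖b‖`. Upper bound
(`norm_sum_affinePow_sq_le`): the matrix of `Cσ` has entries `n.choose k * a ^ k * b ^ (n - k)`. The
Schur test with geometric weights `s ^ n` and `t ^ k`, `t = s A / (1 - s B)`, gives `‖Cσ‖² ≤ 1 / (1
- s B)` as soon as `t A + B ≤ s`. Lower bound (`le_norm_affine_compositionOperator_sq`): `Cσ` maps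
the geometric series `1 / (1 - w z)` to a multiple of another one, and the quotient of the norms is
explicit. For `B > 0` the two bounds meet when `s` is the smaller solution of `t A + B = s` and `‖w‖
= s`, or `‖w‖ → 1` if `s = 1`; this `s` turns `1 / (1 - s B)` into the closed formula. The case `B =
0` is elementary. -/

open scoped ComplexConjugate InnerProductSpace

/-! ### Square-summable coefficients and point evaluations. -/

namespace EllTwo

theorem hasSum_norm_sq (a : EllTwo) : HasSum (fun n => ‖a n‖ ^ 2) (‖a‖ ^ 2) := by
  have h := lp.hasSum_norm (p := 2) (by norm_num) a
  norm_num at h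
  exact h

theorem memℓp_two_of_summable {a : ℕ → ℂ} (h : Summable fun n => ‖a n‖ ^ 2) :
    Memℓp a (2 : ENNReal) := by
  refine memℓp_gen ?_
  norm_num
  exact h

theorem hasSum_geometric_norm_sq {w : ℂ} (hw : ‖w‖ < 1) :
    HasSum (fun n => ‖w ^ n‖ ^ 2) (1 - ‖w‖ ^ 2)⁻¹ := by
  have h : ‖w‖ ^ 2 < 1 := by
    rw [sq_lt_one_iff₀ (norm_nonneg w)]; exact hw
  have := hasSum_geometric_of_lt_one (sq_nonneg ‖w‖) h
  refine this.congr_fun fun n => ?_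
  rw [norm_pow, pow_right_comm]

/-- The geometric sequence `n ↦ wⁿ`, for `‖w‖ < 1`. -/
noncomputable def geometric (w : ℂ) (hw : ‖w‖ < 1) : EllTwo :=
  ⟨fun n => w ^ n, memℓp_two_of_summable (hasSum_geometric_norm_sq hw).summable⟩

theorem geometric_apply (w : ℂ) (hw : ‖w‖ < 1) (n : ℕ) : geometric w hw n = w ^ n := rfl

theorem norm_geometric_sq (w : ℂ) (hw : ‖w‖ < 1) :
    ‖geometric w hw‖ ^ 2 = (1 - ‖w‖ ^ 2)⁻¹ :=
  (hasSum_norm_sq _).unique (hasSum_geometric_norm_sq hw)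

theorem norm_conj_coe_lt_one (z : 𝔻) : ‖conj (z : ℂ)‖ < 1 := by
  rw [RCLike.norm_conj]; exact z.norm_lt_one

/-- The value at `z` of the power series with coefficients `a`, as a continuous functional. -/
noncomputable def eval (z : 𝔻) : EllTwo →L[ℂ] ℂ :=
  innerSL ℂ (geometric (conj (z : ℂ)) (norm_conj_coe_lt_one z))

theorem hasSum_eval (z : 𝔻) (a : EllTwo) :
    HasSum (fun n => a n * (z : ℂ) ^ n) (eval z a) := by
  have h := lp.hasSum_inner (𝕜 := ℂ) (geometric (conj (z : ℂ)) (norm_conj_coe_lt_one z)) a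
  refine h.congr_fun fun n => ?_
  simp [geometric_apply]

end EllTwo

namespace HardySpace

/-- The element of the Hardy space with given square-summable coefficients. -/
noncomputable def ofCoeff (a : EllTwo) : HardySpace :=
  ⟨fun z => EllTwo.eval z a, a, fun z => EllTwo.hasSum_eval z a⟩

theorem ofCoeff_apply (a : EllTwo) (z : 𝔻) : ofCoeff a z = EllTwo.eval z a := rfl

theorem coeff_ofCoeff (a : EllTwo) : coeff (ofCoeff a) = a :=
  coeff_eq _ _ fun z => EllTwo.hasSum_eval z a

theorem apply_eq_eval (f : HardySpace) (z : 𝔻) : f z = EllTwo.eval z (coeff f) :=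
  (f.hasSum_coeff z).unique (EllTwo.hasSum_eval z _)

theorem norm_eq_norm_coeff (f : HardySpace) : ‖f‖ = ‖coeff f‖ := rfl

/-- The coefficient map as a linear isometric equivalence of the Hardy space with `ℓ²(ℕ)`. -/
noncomputable def coeffEquiv : HardySpace ≃ₗᵢ[ℂ] EllTwo where
  toLinearEquiv := LinearEquiv.ofBijective coeffLinear
    ⟨coeffLinear_injective, fun a => ⟨ofCoeff a, coeff_ofCoeff a⟩⟩
  norm_map' _ := rfl

/-- An operator on coefficients that sends the `n`-th unit vector to the coefficients of `φⁿ`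
is the composition operator with symbol `φ`. -/
theorem isCompositionOperator_of_hasSum {φ : 𝔻 → 𝔻} {v : ℕ → EllTwo}
    (hv : ∀ n (z : 𝔻), EllTwo.eval z (v n) = (φ z : ℂ) ^ n) {T : EllTwo →L[ℂ] EllTwo}
    (hT : ∀ a : EllTwo, HasSum (fun n => a n • v n) (T a)) :
    IsCompositionOperator φ
      ((coeffEquiv.symm : EllTwo →L[ℂ] HardySpace) ∘L T ∘L
        (coeffEquiv : HardySpace →L[ℂ] EllTwo)) := by
  intro f z
  have h1 := (hT (coeff f)).mapL (EllTwo.eval z)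
  simp only [map_smul, hv, smul_eq_mul] at h1
  rw [apply_eq_eval]
  have h2 : coeff (((coeffEquiv.symm : EllTwo →L[ℂ] HardySpace) ∘L T ∘L
      (coeffEquiv : HardySpace →L[ℂ] EllTwo)) f) = T (coeff f) :=
    coeffEquiv.apply_symm_apply _
  rw [h2]
  exact h1.unique (f.hasSum_coeff (φ z))

end HardySpace

/-! ### Bounded operators from Bessel bounds, and the Schur test. -/

/-- A sequence of vectors with an upper Riesz (Bessel) bound defines a bounded operator
on `ℓ²(ℕ)`. -/
theorem EllTwo.exists_clm_of_bessel_bound {E : Type*} [NormedAddCommGroup E] [NormedSpace ℂ E]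
    [CompleteSpace E] {v : ℕ → E} {K : ℝ} (hK : 0 ≤ K)
    (h : ∀ (s : Finset ℕ) (c : ℕ → ℂ), ‖∑ n ∈ s, c n • v n‖ ^ 2 ≤ K * ∑ n ∈ s, ‖c n‖ ^ 2) :
    ∃ T : EllTwo →L[ℂ] E, (∀ a : EllTwo, HasSum (fun n => a n • v n) (T a)) ∧
      ‖T‖ ≤ Real.sqrt K := by
  have hs : ∀ a : EllTwo, Summable fun n => a n • v n := by
    intro a
    rw [summable_iff_vanishing_norm]
    intro ε hε
    -- `K + 1` rather than `K`, since `K` may be zero.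
    have hδ : 0 < ε ^ 2 / (K + 1) := by positivity
    obtain ⟨s, hs⟩ := summable_iff_vanishing_norm.1 (EllTwo.hasSum_norm_sq a).summable _ hδ
    refine ⟨s, fun t ht => ?_⟩
    have h1 := hs t ht
    rw [Real.norm_of_nonneg (Finset.sum_nonneg fun _ _ => by positivity),
      lt_div_iff₀ (by positivity)] at h1
    have h2 := h t a
    have h3 : 0 ≤ ∑ n ∈ t, ‖a n‖ ^ 2 := Finset.sum_nonneg fun _ _ => by positivity
    refine lt_of_pow_lt_pow_left₀ 2 hε.le ?_
    nlinarith
  let T₀ : EllTwo →ₗ[ℂ] E :=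
    { toFun := fun a => ∑' n, a n • v n
      map_add' := fun a b => by
        rw [← (hs a).tsum_add (hs b)]
        exact tsum_congr fun n => by simp [add_smul]
      map_smul' := fun c a => by
        rw [RingHom.id_apply, ← (hs a).tsum_const_smul c]
        exact tsum_congr fun n => by simp [mul_smul] }
  have hT : ∀ a : EllTwo, HasSum (fun n => a n • v n) (T₀ a) := fun a => (hs a).hasSum
  have hb : ∀ a, ‖T₀ a‖ ≤ Real.sqrt K * ‖a‖ := by
    intro a
    have h1 : ‖T₀ a‖ ^ 2 ≤ K * ‖a‖ ^ 2 :=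
      le_of_tendsto_of_tendsto' ((hT a).norm.pow 2)
        (Tendsto.const_mul K (EllTwo.hasSum_norm_sq a)) fun s => h s a
    rw [← Real.sqrt_sq (norm_nonneg a), ← Real.sqrt_mul hK]
    exact Real.le_sqrt_of_sq_le h1
  exact ⟨T₀.mkContinuous _ hb, hT, T₀.mkContinuous_norm_le (Real.sqrt_nonneg K) hb⟩

/-- **Schur test** for finite matrices. -/
theorem Finset.schur_test {ι κ : Type*} (t : Finset κ) (s : Finset ι) (M : κ → ι → ℂ)
    {p : ι → ℝ} {q : κ → ℝ} {α β : ℝ} (hα : 0 ≤ α) (hp : ∀ n, 0 < p n)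
    (h1 : ∀ k ∈ t, ∑ n ∈ s, ‖M k n‖ * p n ≤ α * q k)
    (h2 : ∀ n ∈ s, ∑ k ∈ t, ‖M k n‖ * q k ≤ β * p n) (c : ι → ℂ) :
    ∑ k ∈ t, ‖∑ n ∈ s, M k n * c n‖ ^ 2 ≤ α * β * ∑ n ∈ s, ‖c n‖ ^ 2 := by
  have key : ∀ k ∈ t, ‖∑ n ∈ s, M k n * c n‖ ^ 2 ≤
      α * q k * ∑ n ∈ s, ‖M k n‖ * ‖c n‖ ^ 2 / p n := by
    intro k hk
    calc ‖∑ n ∈ s, M k n * c n‖ ^ 2 ≤ (∑ n ∈ s, ‖M k n‖ * ‖c n‖) ^ 2 := by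
          gcongr
          exact (norm_sum_le _ _).trans (Finset.sum_le_sum fun n _ => (norm_mul _ _).le)
      -- Cauchy–Schwarz, with `‖M‖ ‖c‖` split as the geometric mean of `‖M‖ p` and `‖M‖ ‖c‖² / p`.
      _ ≤ (∑ n ∈ s, ‖M k n‖ * p n) * ∑ n ∈ s, ‖M k n‖ * ‖c n‖ ^ 2 / p n := by
          refine Finset.sum_sq_le_sum_mul_sum_of_sq_le_mul s
            (fun n _ => mul_nonneg (norm_nonneg _) (hp n).le)
            (fun n _ => div_nonneg (by positivity) (hp n).le) fun n _ => le_of_eq ?_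
          have := (hp n).ne'
          field_simp
      _ ≤ _ := by
          refine mul_le_mul_of_nonneg_right (h1 k hk) (Finset.sum_nonneg fun n _ => ?_)
          exact div_nonneg (by positivity) (hp n).le
  calc ∑ k ∈ t, ‖∑ n ∈ s, M k n * c n‖ ^ 2
      ≤ ∑ k ∈ t, α * q k * ∑ n ∈ s, ‖M k n‖ * ‖c n‖ ^ 2 / p n := Finset.sum_le_sum key
    _ = α * ∑ n ∈ s, (∑ k ∈ t, ‖M k n‖ * q k) * (‖c n‖ ^ 2 / p n) := by
        simp_rw [Finset.mul_sum, Finset.sum_mul, Finset.mul_sum]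
        rw [Finset.sum_comm]
        exact Finset.sum_congr rfl fun _ _ => Finset.sum_congr rfl fun _ _ => by ring
    _ ≤ α * ∑ n ∈ s, β * p n * (‖c n‖ ^ 2 / p n) := by
        gcongr with n hn
        · exact div_nonneg (by positivity) (hp n).le
        · exact h2 n hn
    _ = α * β * ∑ n ∈ s, ‖c n‖ ^ 2 := by
        rw [mul_assoc, Finset.mul_sum (a := β)]
        congr 1
        refine Finset.sum_congr rfl fun n _ => ?_
        have := (hp n).ne'
        field_simp

/-! ### The matrix of an affine composition operator. -/

namespace EllTwo

/-- The coefficients of the polynomial `(a z + b) ^ n`. -/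
noncomputable def affinePow (a b : ℂ) (n : ℕ) : EllTwo :=
  ⟨fun k => n.choose k * a ^ k * b ^ (n - k), memℓp_two_of_summable <|
    summable_of_ne_finset_zero (s := Finset.range (n + 1)) fun k hk => by
      rw [Nat.choose_eq_zero_of_lt (by simpa using hk)]; simp⟩

theorem affinePow_apply (a b : ℂ) (n k : ℕ) :
    affinePow a b n k = n.choose k * a ^ k * b ^ (n - k) := rfl

theorem affinePow_apply_of_lt (a b : ℂ) {n k : ℕ} (h : n < k) : affinePow a b n k = 0 := by
  rw [affinePow_apply, Nat.choose_eq_zero_of_lt h]; simp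

theorem norm_affinePow_apply (a b : ℂ) (n k : ℕ) :
    ‖affinePow a b n k‖ = n.choose k * ‖a‖ ^ k * ‖b‖ ^ (n - k) := by
  simp [affinePow_apply]

theorem eval_affinePow (a b : ℂ) (n : ℕ) (z : 𝔻) :
    eval z (affinePow a b n) = (a * z + b) ^ n := by
  refine (hasSum_eval z _).unique ?_
  rw [add_pow]
  have h : HasSum (fun k => affinePow a b n k * (z : ℂ) ^ k)
      (∑ k ∈ Finset.range (n + 1), affinePow a b n k * (z : ℂ) ^ k) :=
    hasSum_sum_of_ne_finset_zero fun k hk => by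
      rw [affinePow_apply_of_lt a b (by simpa using hk), zero_mul]
  convert h using 1
  refine Finset.sum_congr rfl fun k _ => ?_
  rw [affinePow_apply]; ring

/-- Row sums for the Schur test. The entries with `n < k` vanish; after a shift by `k` this is the
negative binomial series `∑ (n + k).choose k * x ^ n = (1 - x)⁻¹ ^ (k + 1)` at `x = s ‖b‖`. -/
theorem hasSum_norm_affinePow_mul_pow (a b : ℂ) {s : ℝ} (hs : 0 ≤ s) (hsb : s * ‖b‖ < 1) (k : ℕ) :
    HasSum (fun n => ‖affinePow a b n k‖ * s ^ n)
      ((1 - s * ‖b‖)⁻¹ * (s * ‖a‖ / (1 - s * ‖b‖)) ^ k) := by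
  have h0 : ‖s * ‖b‖‖ < 1 := by
    rwa [Real.norm_of_nonneg (by positivity)]
  have h := (hasSum_choose_mul_geometric_of_norm_lt_one k h0).mul_right (s ^ k * ‖a‖ ^ k)
  rw [← hasSum_nat_add_iff' k, Finset.sum_eq_zero, sub_zero]
  · have hv : (1 - s * ‖b‖)⁻¹ * (s * ‖a‖ / (1 - s * ‖b‖)) ^ k =
        1 / (1 - s * ‖b‖) ^ (k + 1) * (s ^ k * ‖a‖ ^ k) := by
      have : 1 - s * ‖b‖ ≠ 0 := by linarith
      rw [div_pow, mul_pow, pow_succ]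
      field_simp
    rw [hv]
    refine h.congr_fun fun n => ?_
    rw [norm_affinePow_apply, Nat.add_sub_cancel]
    ring
  · intro n hn
    rw [affinePow_apply_of_lt a b (by simpa using hn)]; simp

/-- Column sums for the Schur test: the full column sum is the binomial expansion of the right side,
and all terms are nonnegative. -/
theorem sum_norm_affinePow_mul_pow_le (a b : ℂ) {t : ℝ} (ht : 0 ≤ t) (n : ℕ) (u : Finset ℕ) :
    ∑ k ∈ u, ‖affinePow a b n k‖ * t ^ k ≤ (t * ‖a‖ + ‖b‖) ^ n := by
  rw [add_pow]
  calc ∑ k ∈ u, ‖affinePow a b n k‖ * t ^ k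
      ≤ ∑ k ∈ u ∪ Finset.range (n + 1), ‖affinePow a b n k‖ * t ^ k :=
        Finset.sum_le_sum_of_subset_of_nonneg Finset.subset_union_left
          fun _ _ _ => by positivity
    _ = ∑ k ∈ Finset.range (n + 1), ‖affinePow a b n k‖ * t ^ k := by
        refine (Finset.sum_subset Finset.subset_union_right fun k _ hk => ?_).symm
        rw [affinePow_apply_of_lt a b (by simpa using hk)]; simp
    _ = _ := by
        refine le_antisymm ?_ ?_ <;> refine Finset.sum_le_sum fun k _ => ?_ <;>
        · rw [norm_affinePow_apply]
          exact le_of_eq (by ring)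

/-- Schur test with `p n = s ^ n`, `q k = t ^ k`, `t = s ‖a‖ / (1 - s ‖b‖)`. The row sums produce
exactly `t ^ k`, at the cost of the factor `(1 - s ‖b‖)⁻¹`; `hfix` returns the column sums to `s ^
n` with constant `1`. -/
theorem norm_sum_affinePow_sq_le (a b : ℂ) {s : ℝ} (hs : 0 < s) (hsb : s * ‖b‖ < 1)
    (hfix : s * ‖a‖ / (1 - s * ‖b‖) * ‖a‖ + ‖b‖ ≤ s) (u : Finset ℕ) (c : ℕ → ℂ) :
    ‖∑ n ∈ u, c n • affinePow a b n‖ ^ 2 ≤ (1 - s * ‖b‖)⁻¹ * ∑ n ∈ u, ‖c n‖ ^ 2 := by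
  have hL : 0 < 1 - s * ‖b‖ := by linarith
  have ht : 0 ≤ s * ‖a‖ / (1 - s * ‖b‖) := by positivity
  refine hasSum_le_of_sum_le (hasSum_norm_sq _) fun v => ?_
  have := Finset.schur_test v u (fun k n => affinePow a b n k) (p := fun n => s ^ n)
    (q := fun k => (s * ‖a‖ / (1 - s * ‖b‖)) ^ k) (α := (1 - s * ‖b‖)⁻¹) (β := 1)
    (by positivity) (fun n => by positivity)
    (fun k _ => sum_le_hasSum u (fun _ _ => by positivity)
      (hasSum_norm_affinePow_mul_pow a b hs.le hsb k))
    (fun n _ => by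
      rw [one_mul]
      exact (sum_norm_affinePow_mul_pow_le a b ht n v).trans
        (pow_le_pow_left₀ (by positivity) hfix n)) c
  rw [mul_one] at this
  refine le_of_eq_of_le (Finset.sum_congr rfl fun k _ => ?_) this
  rw [lp.coeFn_sum, Finset.sum_apply]
  congr 2
  exact Finset.sum_congr rfl fun n _ => by simp [mul_comm]

end EllTwo

/-! ### Upper and lower norm bounds for an affine symbol. -/

namespace HardySpace

theorem exists_affine_compositionOperator_norm_le {a b : ℂ} {σ : 𝔻 → 𝔻}
    (hσ : ∀ z : 𝔻, (σ z : ℂ) = a * z + b) {s : ℝ} (hs : 0 < s) (hsb : s * ‖b‖ < 1)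
    (hfix : s * ‖a‖ / (1 - s * ‖b‖) * ‖a‖ + ‖b‖ ≤ s) :
    ∃ C : HardySpace →L[ℂ] HardySpace, IsCompositionOperator σ C ∧
      ‖C‖ ^ 2 ≤ (1 - s * ‖b‖)⁻¹ := by
  have hL : 0 < 1 - s * ‖b‖ := by linarith
  obtain ⟨T, hT, hT'⟩ := EllTwo.exists_clm_of_bessel_bound (inv_nonneg.2 hL.le)
    (EllTwo.norm_sum_affinePow_sq_le a b hs hsb hfix)
  refine ⟨_, isCompositionOperator_of_hasSum
    (fun n z => by rw [EllTwo.eval_affinePow, hσ]) hT, ?_⟩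
  rw [← Real.le_sqrt (norm_nonneg _) (inv_nonneg.2 hL.le)]
  refine ContinuousLinearMap.opNorm_le_bound _ (Real.sqrt_nonneg _) fun f => ?_
  calc _ = ‖T (coeff f)‖ := coeffEquiv.symm.norm_map _
    _ ≤ _ := T.le_of_opNorm_le hT' _

/-- Test `C` on `1 / (1 - w z)` with `‖w‖ = r`. Since `1 - w (a z + b) = (1 - w b) (1 - w a / (1 - w
b) * z)`, the image is again a scaled geometric series, and both norms are known. -/
theorem le_norm_affine_compositionOperator_sq {a b : ℂ} {σ : 𝔻 → 𝔻}
    (hσ : ∀ z : 𝔻, (σ z : ℂ) = a * z + b) (hab : ‖a‖ + ‖b‖ ≤ 1)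
    {C : HardySpace →L[ℂ] HardySpace} (hC : IsCompositionOperator σ C)
    {r : ℝ} (hr0 : 0 ≤ r) (hr1 : r < 1) :
    (1 - r ^ 2) / ((1 - r * ‖b‖) ^ 2 - (r * ‖a‖) ^ 2) ≤ ‖C‖ ^ 2 := by
  -- The phase of `w` cancels that of `b`, which makes `‖1 - w b‖` as small as possible. For `b = 0`
  -- any phase will do, but `conj b / ‖b‖` no longer has modulus one.
  obtain ⟨w, hw, hwb⟩ : ∃ w : ℂ, ‖w‖ = r ∧ w * b = (r * ‖b‖ : ℝ) := by
    obtain rfl | hb := eq_or_ne b 0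
    · exact ⟨r, by simp [abs_of_nonneg hr0], by simp⟩
    · have hb' : (‖b‖ : ℂ) ≠ 0 := by simpa using hb
      refine ⟨r * (conj b / ‖b‖), ?_, ?_⟩
      · rw [norm_mul, norm_div, RCLike.norm_conj, Complex.norm_real, Complex.norm_real, norm_norm,
          div_self (by simpa using hb), mul_one, Real.norm_of_nonneg hr0]
      · have : conj b * b = (‖b‖ : ℂ) ^ 2 := by
          rw [mul_comm]; exact Complex.mul_conj' b
        push_cast
        rw [mul_assoc, div_mul_eq_mul_div, this]
        field_simp
  have hrb : 0 < 1 - r * ‖b‖ := by nlinarith [norm_nonneg a, norm_nonneg b]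
  have hra : r * ‖a‖ < 1 - r * ‖b‖ := by nlinarith [norm_nonneg a, norm_nonneg b]
  have hD : (1 - w * b) = ((1 - r * ‖b‖ : ℝ) : ℂ) := by rw [hwb]; push_cast; ring
  have hnD : ‖1 - w * b‖ = 1 - r * ‖b‖ := by
    rw [hD, Complex.norm_real, Real.norm_of_nonneg hrb.le]
  have hD0 : 1 - w * b ≠ 0 := by rw [← norm_pos_iff, hnD]; exact hrb
  have hw1 : ‖w‖ < 1 := hw ▸ hr1
  have hn2 : ‖w * a / (1 - w * b)‖ = r * ‖a‖ / (1 - r * ‖b‖) := by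
    rw [norm_div, norm_mul, hnD, hw]
  have hw2 : ‖w * a / (1 - w * b)‖ < 1 := by
    rw [hn2, div_lt_one hrb]; exact hra
  have hgeo : ∀ (x : ℂ) (hx : ‖x‖ < 1) (z : 𝔻),
      EllTwo.eval z (EllTwo.geometric x hx) = (1 - x * z)⁻¹ := by
    intro x hx z
    refine (EllTwo.hasSum_eval z _).unique ?_
    have h1 : ‖x * z‖ < 1 := by
      rw [norm_mul]; nlinarith [norm_nonneg x, norm_nonneg (z : ℂ), z.norm_lt_one]
    refine (hasSum_geometric_of_norm_lt_one h1).congr_fun fun n => ?_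
    rw [EllTwo.geometric_apply, mul_pow]
  have hCf : C (ofCoeff (EllTwo.geometric w hw1)) =
      ofCoeff ((1 - w * b)⁻¹ • EllTwo.geometric _ hw2) := by
    refine Subtype.ext (funext fun z => ?_)
    refine (hC _ z).trans ?_
    rw [ofCoeff_apply, hgeo, hσ]
    refine Eq.trans ?_ (ofCoeff_apply _ z).symm
    rw [map_smul, hgeo, smul_eq_mul, ← mul_inv]
    congr 1
    field_simp
    ring
  have h := C.le_opNorm (ofCoeff (EllTwo.geometric w hw1))
  rw [hCf, norm_eq_norm_coeff, norm_eq_norm_coeff, coeff_ofCoeff, coeff_ofCoeff, norm_smul,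
    norm_inv, hnD] at h
  have h2 := pow_le_pow_left₀ (by positivity) h 2
  rw [mul_pow, mul_pow, EllTwo.norm_geometric_sq, EllTwo.norm_geometric_sq, hn2, hw] at h2
  have h3 : 0 < 1 - r ^ 2 := by nlinarith
  have h4 : 0 < (1 - r * ‖b‖) ^ 2 - (r * ‖a‖) ^ 2 := by
    have := mul_nonneg hr0 (norm_nonneg a)
    nlinarith
  rw [← div_eq_mul_inv, ← div_eq_mul_inv, le_div_iff₀ h3] at h2
  refine le_of_eq_of_le ?_ h2
  have h5 : 1 - (r * ‖a‖ / (1 - r * ‖b‖)) ^ 2 =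
      ((1 - r * ‖b‖) ^ 2 - (r * ‖a‖) ^ 2) / (1 - r * ‖b‖) ^ 2 := by
    field_simp
  rw [h5]
  field_simp

end HardySpace

/-! ### Fourier series on the circle. -/

theorem integral_exp_pow_mul_conj_exp_pow (n m : ℕ) :
    ∫ θ in (0 : ℝ)..2 * Real.pi,
      Complex.exp (θ * Complex.I) ^ n * conj (Complex.exp (θ * Complex.I) ^ m) =
        if n = m then 2 * Real.pi else 0 := by
  have h : ∀ θ : ℝ, Complex.exp (θ * Complex.I) ^ n * conj (Complex.exp (θ * Complex.I) ^ m) =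
      Complex.exp ((n - m) * Complex.I * θ) := by
    intro θ
    rw [map_pow, ← Complex.exp_conj, ← Complex.exp_nat_mul, ← Complex.exp_nat_mul,
      ← Complex.exp_add]
    congr 1
    simp
    ring
  simp_rw [h]
  split_ifs with hnm
  · subst hnm
    simp
  · have hc : ((n : ℂ) - m) * Complex.I ≠ 0 :=
      mul_ne_zero (sub_ne_zero.2 (by exact_mod_cast hnm)) Complex.I_ne_zero
    rw [integral_exp_mul_complex hc]
    have h1 : Complex.exp ((n - m) * Complex.I * ((2 * Real.pi : ℝ) : ℂ)) = 1 := by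
      rw [Complex.exp_eq_one_iff]
      exact ⟨n - m, by push_cast; ring⟩
    rw [h1]
    simp

theorem norm_exp_pow_mul_I (θ : ℝ) (n : ℕ) : ‖Complex.exp (θ * Complex.I) ^ n‖ = 1 := by
  rw [norm_pow, Complex.norm_exp_ofReal_mul_I, one_pow]

theorem continuous_of_hasSum_mul_exp_pow {a : ℕ → ℂ} (ha : Summable fun n => ‖a n‖) {F : ℝ → ℂ}
    (hF : ∀ θ : ℝ, HasSum (fun n => a n * Complex.exp (θ * Complex.I) ^ n) (F θ)) :
    Continuous F := by
  have h : F = fun θ : ℝ => ∑' n, a n * Complex.exp (θ * Complex.I) ^ n :=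
    funext fun θ => (hF θ).tsum_eq.symm
  rw [h]
  exact continuous_tsum (fun n => by fun_prop) ha fun n θ => by
    rw [norm_mul, norm_exp_pow_mul_I, mul_one]

theorem integral_mul_conj_exp_pow {a : ℕ → ℂ} (ha : Summable fun n => ‖a n‖) {F : ℝ → ℂ}
    (hF : ∀ θ : ℝ, HasSum (fun n => a n * Complex.exp (θ * Complex.I) ^ n) (F θ)) (m : ℕ) :
    ∫ θ in (0 : ℝ)..2 * Real.pi, F θ * conj (Complex.exp (θ * Complex.I) ^ m) =
      2 * Real.pi * a m := by
  have h := intervalIntegral.hasSum_integral_of_dominated_convergence (μ := volume)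
    (a := 0) (b := 2 * Real.pi)
    (F := fun n (θ : ℝ) => a n * Complex.exp (θ * Complex.I) ^ n *
      conj (Complex.exp (θ * Complex.I) ^ m))
    (f := fun θ => F θ * conj (Complex.exp (θ * Complex.I) ^ m))
    (fun n _ => ‖a n‖)
    (fun n => Continuous.aestronglyMeasurable (by fun_prop))
    (fun n => Eventually.of_forall fun θ _ => by
      rw [norm_mul, norm_mul, RCLike.norm_conj, norm_exp_pow_mul_I, norm_exp_pow_mul_I]; simp)
    (Eventually.of_forall fun θ _ => ha) intervalIntegrable_const
    (Eventually.of_forall fun θ _ => (hF θ).mul_right _)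
  refine h.unique ?_
  have h2 : ∀ n, ∫ θ in (0 : ℝ)..2 * Real.pi, a n * Complex.exp (θ * Complex.I) ^ n *
      conj (Complex.exp (θ * Complex.I) ^ m) = if n = m then 2 * Real.pi * a m else 0 := by
    intro n
    simp_rw [mul_assoc]
    rw [intervalIntegral.integral_const_mul, integral_exp_pow_mul_conj_exp_pow]
    split_ifs with hnm
    · subst hnm; push_cast; ring
    · simp
  simp_rw [h2]
  exact hasSum_ite_eq m _

/-- **Parseval's identity** for absolutely convergent one-sided Fourier series. -/
theorem hasSum_mul_conj_of_hasSum_mul_exp_pow {a b : ℕ → ℂ} (ha : Summable fun n => ‖a n‖)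
    (hb : Summable fun n => ‖b n‖) {F G : ℝ → ℂ}
    (hF : ∀ θ : ℝ, HasSum (fun n => a n * Complex.exp (θ * Complex.I) ^ n) (F θ))
    (hG : ∀ θ : ℝ, HasSum (fun n => b n * Complex.exp (θ * Complex.I) ^ n) (G θ)) :
    HasSum (fun n => 2 * Real.pi * (a n * conj (b n)))
      (∫ θ in (0 : ℝ)..2 * Real.pi, F θ * conj (G θ)) := by
  have hFc := continuous_of_hasSum_mul_exp_pow ha hF
  have hFb : ∀ θ, ‖F θ‖ ≤ ∑' n, ‖a n‖ := by
    intro θ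
    rw [← (hF θ).tsum_eq]
    exact tsum_of_norm_bounded ha.hasSum fun n => by
      rw [norm_mul, norm_exp_pow_mul_I, mul_one]
  have h := intervalIntegral.hasSum_integral_of_dominated_convergence (μ := volume)
    (a := 0) (b := 2 * Real.pi)
    (F := fun n (θ : ℝ) => conj (b n) * (F θ * conj (Complex.exp (θ * Complex.I) ^ n)))
    (f := fun θ => F θ * conj (G θ))
    (fun n _ => ‖b n‖ * ∑' n, ‖a n‖)
    (fun n => Continuous.aestronglyMeasurable (by fun_prop))
    (fun n => Eventually.of_forall fun θ _ => by
      rw [norm_mul, norm_mul, RCLike.norm_conj, RCLike.norm_conj, norm_exp_pow_mul_I, mul_one]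
      exact mul_le_mul_of_nonneg_left (hFb θ) (norm_nonneg _))
    (Eventually.of_forall fun θ _ => hb.mul_right _) intervalIntegrable_const
    (Eventually.of_forall fun θ _ => by
      refine ((Complex.hasSum_conj'.2 (hG θ)).mul_left (F θ)).congr_fun fun n => ?_
      rw [map_mul]; ring)
  refine h.congr_fun fun n => ?_
  rw [intervalIntegral.integral_const_mul, integral_mul_conj_exp_pow ha hF]
  ring

/-! ### Circle pairings and their boundary limits. -/

/-- The integral of `f · conj g` over the circle of radius `r`, with respect to arc angle. -/
noncomputable def circlePairing (f g : ℂ → ℂ) (r : ℝ) : ℂ :=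
  ∫ θ in (0 : ℝ)..2 * Real.pi, f (r * Complex.exp (θ * Complex.I)) *
    conj (g (r * Complex.exp (θ * Complex.I)))

theorem norm_mul_exp_mul_I_lt_one {r : ℝ} (hr0 : 0 ≤ r) (hr1 : r < 1) (θ : ℝ) :
    ‖r * Complex.exp (θ * Complex.I)‖ < 1 := by
  rw [norm_mul, Complex.norm_exp_ofReal_mul_I, mul_one, Complex.norm_real,
    Real.norm_of_nonneg hr0]
  exact hr1

theorem summable_norm_mul_pow_of_hasSum {a : ℕ → ℂ} {f : ℂ → ℂ}
    (hf : ∀ z : ℂ, ‖z‖ < 1 → HasSum (fun n => a n * z ^ n) (f z)) {r : ℝ} (hr0 : 0 ≤ r)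
    (hr1 : r < 1) : Summable fun n => ‖a n * r ^ n‖ := by
  have h := (hf r (by rwa [Complex.norm_real, Real.norm_of_nonneg hr0])).summable
  exact h.norm

theorem hasSum_circlePairing {a b : ℕ → ℂ} {f g : ℂ → ℂ}
    (hf : ∀ z : ℂ, ‖z‖ < 1 → HasSum (fun n => a n * z ^ n) (f z))
    (hg : ∀ z : ℂ, ‖z‖ < 1 → HasSum (fun n => b n * z ^ n) (g z)) {r : ℝ} (hr0 : 0 ≤ r)
    (hr1 : r < 1) :
    HasSum (fun n => 2 * Real.pi * (a n * conj (b n) * (r ^ 2) ^ n)) (circlePairing f g r) := by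
  have h := hasSum_mul_conj_of_hasSum_mul_exp_pow
    (F := fun θ => f (r * Complex.exp (θ * Complex.I)))
    (G := fun θ => g (r * Complex.exp (θ * Complex.I)))
    (summable_norm_mul_pow_of_hasSum hf hr0 hr1) (summable_norm_mul_pow_of_hasSum hg hr0 hr1)
    (fun θ => (hf _ (norm_mul_exp_mul_I_lt_one hr0 hr1 θ)).congr_fun fun n => by
      rw [mul_pow, mul_assoc])
    (fun θ => (hg _ (norm_mul_exp_mul_I_lt_one hr0 hr1 θ)).congr_fun fun n => by
      rw [mul_pow, mul_assoc])
  refine h.congr_fun fun n => ?_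
  rw [map_mul, map_pow, Complex.conj_ofReal]
  ring

theorem eventually_mem_Ico_nhdsLT_one : ∀ᶠ r : ℝ in 𝓝[<] 1, 0 ≤ r ∧ r < 1 := by
  filter_upwards [Ioo_mem_nhdsLT (zero_lt_one' ℝ)] with r hr
  exact ⟨hr.1.le, hr.2⟩

/-- Parseval on the circle of radius `r` bounds `∑ ‖a n‖² r ^ (2 n)` by one. For a finite sum the
limit `r → 1` is plain continuity. -/
theorem sum_norm_sq_le_of_norm_le_one {a : ℕ → ℂ} {f : ℂ → ℂ}
    (hf : ∀ z : ℂ, ‖z‖ < 1 → HasSum (fun n => a n * z ^ n) (f z))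
    (hb : ∀ z : ℂ, ‖z‖ < 1 → ‖f z‖ ≤ 1) (s : Finset ℕ) : ∑ n ∈ s, ‖a n‖ ^ 2 ≤ 1 := by
  have key : ∀ r : ℝ, 0 ≤ r ∧ r < 1 → ∑ n ∈ s, ‖a n‖ ^ 2 * (r ^ 2) ^ n ≤ 1 := by
    rintro r ⟨hr0, hr1⟩
    have h1 := hasSum_circlePairing hf hf hr0 hr1
    have h2 : ‖circlePairing f f r‖ ≤ 2 * Real.pi := by
      have := intervalIntegral.norm_integral_le_of_norm_le_const (a := 0) (b := 2 * Real.pi)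
        (C := 1) (f := fun θ => f (r * Complex.exp (θ * Complex.I)) *
          conj (f (r * Complex.exp (θ * Complex.I)))) fun θ _ => by
            rw [norm_mul, RCLike.norm_conj]
            exact mul_le_one₀ (hb _ (norm_mul_exp_mul_I_lt_one hr0 hr1 θ)) (norm_nonneg _)
              (hb _ (norm_mul_exp_mul_I_lt_one hr0 hr1 θ))
      rwa [one_mul, sub_zero, abs_of_pos Real.two_pi_pos] at this
    have h3 : HasSum (fun n => 2 * Real.pi * (‖a n‖ ^ 2 * (r ^ 2) ^ n)) (circlePairing f f r).re := by
      refine (Complex.hasSum_re h1).congr_fun fun n => ?_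
      rw [Complex.mul_conj', ← Complex.ofReal_re (2 * Real.pi * (‖a n‖ ^ 2 * (r ^ 2) ^ n))]
      push_cast
      rfl
    have h4 := (sum_le_hasSum s (fun n _ => by positivity) h3).trans
      ((Complex.re_le_norm _).trans h2)
    rw [← Finset.mul_sum] at h4
    nlinarith [Real.two_pi_pos]
  have hc : Continuous fun r : ℝ => ∑ n ∈ s, ‖a n‖ ^ 2 * (r ^ 2) ^ n := by fun_prop
  have hl : Tendsto (fun r : ℝ => ∑ n ∈ s, ‖a n‖ ^ 2 * (r ^ 2) ^ n) (𝓝[<] 1)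
      (𝓝 (∑ n ∈ s, ‖a n‖ ^ 2)) := by
    have := (hc.tendsto 1).mono_left (nhdsWithin_le_nhds (s := Set.Iio 1))
    simpa using this
  exact le_of_tendsto hl (eventually_mem_Ico_nhdsLT_one.mono key)

/-- A holomorphic function on the disc bounded by `1` has square-summable Taylor coefficients. -/
theorem exists_ellTwo_hasSum_of_norm_le_one {f : ℂ → ℂ}
    (hf : DifferentiableOn ℂ f (Metric.ball 0 1)) (hb : ∀ z : ℂ, ‖z‖ < 1 → ‖f z‖ ≤ 1) :
    ∃ a : EllTwo, ∀ z : ℂ, ‖z‖ < 1 → HasSum (fun n => a n * z ^ n) (f z) := by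
  have h : ∀ z : ℂ, ‖z‖ < 1 →
      HasSum (fun n : ℕ => ((n.factorial : ℂ)⁻¹ * iteratedDeriv n f 0) * z ^ n) (f z) := by
    intro z hz
    refine (Complex.hasSum_taylorSeries_on_ball hf (by simpa using hz)).congr_fun fun n => ?_
    simp only [sub_zero, smul_eq_mul]
    ring
  exact ⟨⟨_, EllTwo.memℓp_two_of_summable (summable_of_sum_le (fun n => by positivity)
    (sum_norm_sq_le_of_norm_le_one h hb))⟩, h⟩

/-- The inner product of coefficient sequences is the boundary limit of the circle pairings. -/
theorem tendsto_circlePairing {a b : EllTwo} {f g : ℂ → ℂ}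
    (hf : ∀ z : ℂ, ‖z‖ < 1 → HasSum (fun n => a n * z ^ n) (f z))
    (hg : ∀ z : ℂ, ‖z‖ < 1 → HasSum (fun n => b n * z ^ n) (g z)) :
    Tendsto (circlePairing f g) (𝓝[<] 1) (𝓝 (2 * Real.pi * ⟪b, a⟫_ℂ)) := by
  have hin := lp.hasSum_inner (𝕜 := ℂ) b a
  have hlim : Tendsto (fun r : ℝ => ∑' n, 2 * Real.pi * (a n * conj (b n) * (r ^ 2 : ℂ) ^ n))
      (𝓝[<] 1) (𝓝 (∑' n, 2 * Real.pi * (a n * conj (b n)))) := by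
    refine tendsto_tsum_of_dominated_convergence
      (bound := fun n => 2 * Real.pi * ‖⟪b n, a n⟫_ℂ‖) (hin.summable.norm.mul_left _) ?_ ?_
    · intro n
      have hc : Continuous fun r : ℝ => 2 * Real.pi * (a n * conj (b n) * (r ^ 2 : ℂ) ^ n) := by
        fun_prop
      have := (hc.tendsto 1).mono_left (nhdsWithin_le_nhds (s := Set.Iio 1))
      simpa using this
    · filter_upwards [eventually_mem_Ico_nhdsLT_one] with r hr n
      have h1 : ‖(r ^ 2 : ℂ) ^ n‖ ≤ 1 := by
        rw [norm_pow, norm_pow, Complex.norm_real, Real.norm_of_nonneg hr.1]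
        exact pow_le_one₀ (by positivity) (pow_le_one₀ hr.1 hr.2.le)
      have h2 : ‖(2 * Real.pi : ℂ)‖ = 2 * Real.pi := by
        rw [← Complex.ofReal_ofNat, ← Complex.ofReal_mul, Complex.norm_real,
          Real.norm_of_nonneg Real.two_pi_pos.le]
      rw [norm_mul, h2, norm_mul]
      refine mul_le_mul_of_nonneg_left ?_ Real.two_pi_pos.le
      refine (mul_le_of_le_one_right (norm_nonneg _) h1).trans_eq ?_
      rw [RCLike.inner_apply]
  have hv : ∑' n, 2 * Real.pi * (a n * conj (b n)) = 2 * Real.pi * ⟪b, a⟫_ℂ := by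
    refine ((hin.mul_left (2 * Real.pi : ℂ)).congr_fun fun n => ?_).tsum_eq
    rw [RCLike.inner_apply]
  rw [hv] at hlim
  refine hlim.congr' ?_
  filter_upwards [eventually_mem_Ico_nhdsLT_one] with r hr
  exact (hasSum_circlePairing hf hg hr.1 hr.2).tsum_eq

/-- The mean value property, read off as the Fourier coefficient of index zero. -/
theorem circlePairing_one_right {a : ℕ → ℂ} {f : ℂ → ℂ}
    (hf : ∀ z : ℂ, ‖z‖ < 1 → HasSum (fun n => a n * z ^ n) (f z)) {r : ℝ} (hr0 : 0 ≤ r)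
    (hr1 : r < 1) : circlePairing f (fun _ => 1) r = 2 * Real.pi * f 0 := by
  have h0 : HasSum (fun n => a n * 0 ^ n) (a 0) := by
    have := hasSum_single (f := fun n => a n * (0 : ℂ) ^ n) 0 fun n hn => by simp [hn]
    simpa using this
  have h := integral_mul_conj_exp_pow (F := fun θ => f (r * Complex.exp (θ * Complex.I)))
    (summable_norm_mul_pow_of_hasSum hf hr0 hr1)
    (fun θ => (hf _ (norm_mul_exp_mul_I_lt_one hr0 hr1 θ)).congr_fun fun n => by
      rw [mul_pow, mul_assoc]) 0
  rw [(hf 0 (by simp)).unique h0]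
  simpa [circlePairing] using h

theorem DifferentiableOn.aestronglyMeasurable_circle {f : ℂ → ℂ}
    (hf : DifferentiableOn ℂ f (Metric.ball 0 1)) {r : ℝ} (hr0 : 0 ≤ r) (hr1 : r < 1)
    (μ : Measure ℝ) :
    AEStronglyMeasurable (fun θ : ℝ => f (r * Complex.exp (θ * Complex.I))) μ :=
  (hf.continuousOn.comp_continuous (by fun_prop) fun θ => by
    simpa using norm_mul_exp_mul_I_lt_one hr0 hr1 θ).aestronglyMeasurable

/-! ### Inner functions vanishing at the origin induce isometries. -/

namespace IsInnerFunction

theorem norm_le_one {ψ : ℂ → ℂ} (h : IsInnerFunction ψ) {z : ℂ} (hz : ‖z‖ < 1) : ‖ψ z‖ ≤ 1 :=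
  h.2.1 z (by simpa using hz)

theorem id_mul {ψ : ℂ → ℂ} (h : IsInnerFunction ψ) : IsInnerFunction fun z => z * ψ z := by
  refine ⟨differentiableOn_id.mul h.1, fun z hz => ?_, ?_⟩
  · rw [norm_mul]
    exact mul_le_one₀ (by simpa using (Metric.mem_ball.1 hz).le) (norm_nonneg _) (h.2.1 z hz)
  · filter_upwards [h.2.2] with θ hθ
    obtain ⟨w, hw, hlim⟩ := hθ
    refine ⟨Complex.exp (θ * Complex.I) * w, by
      rw [norm_mul, Complex.norm_exp_ofReal_mul_I, hw, one_mul], Tendsto.mul ?_ hlim⟩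
    have hc : Continuous fun r : ℝ => (r : ℂ) * Complex.exp (θ * Complex.I) := by fun_prop
    have := (hc.tendsto 1).mono_left (nhdsWithin_le_nhds (s := Set.Iio 1))
    simpa using this

theorem pow_differentiableOn {τ : ℂ → ℂ} (h : IsInnerFunction τ) (n : ℕ) :
    DifferentiableOn ℂ (fun z => τ z ^ n) (Metric.ball 0 1) := h.1.pow n

theorem norm_pow_le_one {τ : ℂ → ℂ} (h : IsInnerFunction τ) (n : ℕ) {z : ℂ} (hz : ‖z‖ < 1) :
    ‖τ z ^ n‖ ≤ 1 := by
  rw [norm_pow]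
  exact pow_le_one₀ (norm_nonneg _) (h.norm_le_one hz)

/-- Taylor coefficients of the powers of an inner function. -/
theorem exists_powCoeff {τ : ℂ → ℂ} (h : IsInnerFunction τ) :
    ∃ v : ℕ → EllTwo, ∀ n, ∀ z : ℂ, ‖z‖ < 1 → HasSum (fun k => v n k * z ^ k) (τ z ^ n) := by
  choose v hv using fun n => exists_ellTwo_hasSum_of_norm_le_one (h.pow_differentiableOn n)
    fun z => h.norm_pow_le_one n
  exact ⟨v, hv⟩

/-- At almost every boundary point `τ` tends to some `w` with `‖w‖ = 1`, so `w ^ (n + d) * conj (w ^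
n) = w ^ d` and the difference of the integrands tends to zero. It is bounded by `2`, so dominated
convergence applies. -/
theorem tendsto_circlePairing_pow_sub {τ : ℂ → ℂ} (h : IsInnerFunction τ) (n d : ℕ) :
    Tendsto (fun r => circlePairing (fun z => τ z ^ (n + d)) (fun z => τ z ^ n) r -
      circlePairing (fun z => τ z ^ d) (fun _ => 1) r) (𝓝[<] 1) (𝓝 0) := by
  have hm : ∀ r : ℝ, 0 ≤ r ∧ r < 1 → ∀ (k : ℕ) (μ : Measure ℝ),
      AEStronglyMeasurable (fun θ : ℝ => τ (r * Complex.exp (θ * Complex.I)) ^ k) μ :=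
    fun r hr k μ => (h.pow_differentiableOn k).aestronglyMeasurable_circle hr.1 hr.2 μ
  have hP : ∀ r : ℝ, 0 ≤ r ∧ r < 1 → ∀ k l (θ : ℝ),
      ‖τ (r * Complex.exp (θ * Complex.I)) ^ k *
        conj (τ (r * Complex.exp (θ * Complex.I)) ^ l)‖ ≤ 1 := by
    intro r hr k l θ
    rw [norm_mul, RCLike.norm_conj]
    exact mul_le_one₀ (h.norm_pow_le_one k (norm_mul_exp_mul_I_lt_one hr.1 hr.2 θ)) (norm_nonneg _)
      (h.norm_pow_le_one l (norm_mul_exp_mul_I_lt_one hr.1 hr.2 θ))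
  have hPm : ∀ r : ℝ, 0 ≤ r ∧ r < 1 → ∀ k l (μ : Measure ℝ),
      AEStronglyMeasurable (fun θ : ℝ => τ (r * Complex.exp (θ * Complex.I)) ^ k *
        conj (τ (r * Complex.exp (θ * Complex.I)) ^ l)) μ := fun r hr k l μ =>
    (hm r hr k μ).mul (Complex.continuous_conj.comp_aestronglyMeasurable (hm r hr l μ))
  have hi : ∀ r : ℝ, 0 ≤ r ∧ r < 1 → ∀ k l, IntervalIntegrable
      (fun θ : ℝ => τ (r * Complex.exp (θ * Complex.I)) ^ k *
        conj (τ (r * Complex.exp (θ * Complex.I)) ^ l)) volume 0 (2 * Real.pi) := by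
    intro r hr k l
    refine (intervalIntegrable_const (c := (1 : ℝ))).mono_fun (hPm r hr k l _)
      (Eventually.of_forall fun θ => ?_)
    simpa using hP r hr k l θ
  have hlim : Tendsto (fun r : ℝ => ∫ θ in (0 : ℝ)..2 * Real.pi,
      (τ (r * Complex.exp (θ * Complex.I)) ^ (n + d) *
        conj (τ (r * Complex.exp (θ * Complex.I)) ^ n) -
      τ (r * Complex.exp (θ * Complex.I)) ^ d *
        conj (τ (r * Complex.exp (θ * Complex.I)) ^ 0))) (𝓝[<] 1)
      (𝓝 (∫ _ in (0 : ℝ)..2 * Real.pi, (0 : ℂ))) := by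
    refine intervalIntegral.tendsto_integral_filter_of_dominated_convergence (fun _ => 2)
      ?_ ?_ intervalIntegrable_const ?_
    · filter_upwards [eventually_mem_Ico_nhdsLT_one] with r hr
      exact (hPm r hr _ _ _).sub (hPm r hr _ _ _)
    · filter_upwards [eventually_mem_Ico_nhdsLT_one] with r hr
      refine Eventually.of_forall fun θ _ => (norm_sub_le _ _).trans ?_
      linarith [hP r hr (n + d) n θ, hP r hr d 0 θ]
    · filter_upwards [h.2.2] with θ hθ _
      obtain ⟨w, hw, hlim⟩ := hθ
      have hp : ∀ k l, Tendsto (fun r : ℝ => τ (r * Complex.exp (θ * Complex.I)) ^ k *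
          conj (τ (r * Complex.exp (θ * Complex.I)) ^ l)) (𝓝[<] 1) (𝓝 (w ^ k * conj (w ^ l))) :=
        fun k l => (hlim.pow k).mul ((Complex.continuous_conj.tendsto _).comp (hlim.pow l))
      have := (hp (n + d) n).sub (hp d 0)
      have hww : w ^ n * conj (w ^ n) = 1 := by
        rw [Complex.mul_conj', norm_pow, hw]; simp
      have h0 : w ^ (n + d) * conj (w ^ n) - w ^ d * conj (w ^ 0) = 0 := by
        rw [pow_add, mul_right_comm, hww]; simp
      rwa [h0] at this
  rw [intervalIntegral.integral_zero] at hlim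
  refine hlim.congr' ?_
  filter_upwards [eventually_mem_Ico_nhdsLT_one] with r hr
  rw [intervalIntegral.integral_sub (hi r hr _ _) (hi r hr _ _)]
  simp [circlePairing]

/-- Powers of an inner function vanishing at the origin are orthonormal in `H²`. -/
theorem orthonormal_powCoeff {τ : ℂ → ℂ} (h : IsInnerFunction τ) (h0 : τ 0 = 0) {v : ℕ → EllTwo}
    (hv : ∀ n, ∀ z : ℂ, ‖z‖ < 1 → HasSum (fun k => v n k * z ^ k) (τ z ^ n)) :
    Orthonormal ℂ v := by
  -- `0 ^ d` is the value of `τ ^ d` at the origin; `0 ^ 0 = 1` makes it cover the norms as well as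
  -- the orthogonality.
  have key : ∀ n d, ⟪v n, v (n + d)⟫_ℂ = 0 ^ d := by
    intro n d
    have h1 := tendsto_circlePairing (hv (n + d)) (hv n)
    have h2 := (h.tendsto_circlePairing_pow_sub n d).add_const (2 * Real.pi * (0 : ℂ) ^ d)
    have h3 : Tendsto (circlePairing (fun z => τ z ^ (n + d)) (fun z => τ z ^ n)) (𝓝[<] 1)
        (𝓝 (0 + 2 * Real.pi * (0 : ℂ) ^ d)) := by
      refine h2.congr' ?_
      filter_upwards [eventually_mem_Ico_nhdsLT_one] with r hr
      rw [circlePairing_one_right (hv d) hr.1 hr.2, h0, sub_add_cancel]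
    have h4 := tendsto_nhds_unique h1 h3
    rw [zero_add] at h4
    exact mul_left_cancel₀ (by simp [Real.pi_ne_zero]) h4
  rw [orthonormal_iff_ite]
  intro i j
  obtain hij | hij := le_total i j
  · obtain ⟨d, rfl⟩ := Nat.exists_eq_add_of_le hij
    rw [key]
    rcases d with _ | d <;> simp
  · obtain ⟨d, rfl⟩ := Nat.exists_eq_add_of_le hij
    rw [← inner_conj_symm, key]
    rcases d with _ | d <;> simp

/-- Composition with an inner function vanishing at the origin is isometric on `H²`. -/
theorem exists_isometric_compositionOperator {τ : ℂ → ℂ} (h : IsInnerFunction τ) (h0 : τ 0 = 0)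
    {φ : 𝔻 → 𝔻} (hφ : ∀ z : 𝔻, (φ z : ℂ) = τ z) :
    ∃ C : HardySpace →L[ℂ] HardySpace, IsCompositionOperator φ C ∧ ∀ f, ‖C f‖ = ‖f‖ := by
  obtain ⟨v, hv⟩ := h.exists_powCoeff
  have ho := (h.orthonormal_powCoeff h0 hv).orthogonalFamily
  refine ⟨_, HardySpace.isCompositionOperator_of_hasSum (v := v)
    (T := ho.linearIsometry.toContinuousLinearMap)
    (fun n z => ?_) (fun a => ?_), fun f => ?_⟩
  · rw [hφ]
    exact (EllTwo.hasSum_eval z _).unique (hv n z z.norm_lt_one)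
  · exact (ho.hasSum_linearIsometry a).congr_fun fun n => by simp
  · exact (HardySpace.coeffEquiv.symm.norm_map _).trans (ho.linearIsometry.norm_map _)

end IsInnerFunction

/-! ### The extremal parameter and the norm formula for an affine symbol. -/

/-- The eigenvalue equation behind the norm of an affine composition operator: the smaller root `s`
of `B s² - (1 - A² + B²) s + B` and the quantity `1 - s B`. -/
theorem exists_affine_fixedPoint {A B : ℝ} (hB : 0 < B) (hAB : A + B ≤ 1)
    (hA : 0 ≤ A) :
    ∃ s : ℝ, 0 < s ∧ s ≤ 1 ∧
      1 - s * B = (1 + A ^ 2 - B ^ 2 +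
        Real.sqrt ((1 - A ^ 2 + B ^ 2) ^ 2 - 4 * B ^ 2)) / 2 ∧
      s * (1 - s * B) = A ^ 2 * s + B * (1 - s * B) := by
  set R := Real.sqrt ((1 - A ^ 2 + B ^ 2) ^ 2 - 4 * B ^ 2) with hR
  -- This is `A² ≤ (1 - B)²`; it gives both a nonnegative discriminant and `s ≤ 1`.
  have h1 : 2 * B ≤ 1 - A ^ 2 + B ^ 2 := by nlinarith
  have hR2 : R ^ 2 = (1 - A ^ 2 + B ^ 2) ^ 2 - 4 * B ^ 2 := Real.sq_sqrt (by nlinarith)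
  have hR0 : 0 ≤ R := Real.sqrt_nonneg _
  have hD : 0 < 1 - A ^ 2 + B ^ 2 + R := by linarith
  -- The roots have product one, so the smaller root is also the reciprocal of the larger one. In
  -- that form its positivity is visible.
  have hs : 2 * B / (1 - A ^ 2 + B ^ 2 + R) = (1 - A ^ 2 + B ^ 2 - R) / (2 * B) := by
    rw [div_eq_div_iff hD.ne' (by positivity)]
    linarith
  have hsB : 2 * B / (1 - A ^ 2 + B ^ 2 + R) * B = (1 - A ^ 2 + B ^ 2 - R) / 2 := by
    rw [hs]; field_simp
  refine ⟨2 * B / (1 - A ^ 2 + B ^ 2 + R), by positivity, ?_, ?_, ?_⟩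
  · rw [div_le_one hD]; linarith
  · rw [hsB]; ring
  · rw [hsB]
    refine mul_right_cancel₀ hB.ne' ?_
    rw [mul_right_comm, hsB, add_mul, mul_assoc (A ^ 2), hsB]
    linarith

theorem norm_affine_add_lt_one {a b z : ℂ} (hb : ‖b‖ < 1) (hab : ‖a‖ + ‖b‖ ≤ 1) (hz : ‖z‖ < 1) :
    ‖a * z + b‖ < 1 := by
  refine (norm_add_le _ _).trans_lt ?_
  rw [norm_mul]
  obtain h | h := (norm_nonneg a).eq_or_lt
  · rw [← h]; simpa using hb
  · nlinarith

namespace HardySpace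

/-- Cowen's formula for the norm of a composition operator with affine symbol. -/
theorem exists_affine_compositionOperator_norm_eq {a b : ℂ} (hb : ‖b‖ < 1)
    (hab : ‖a‖ + ‖b‖ ≤ 1) {σ : 𝔻 → 𝔻} (hσ : ∀ z : 𝔻, (σ z : ℂ) = a * z + b) :
    ∃ C : HardySpace →L[ℂ] HardySpace, IsCompositionOperator σ C ∧
      ‖C‖ = Real.sqrt (2 / (1 + ‖a‖ ^ 2 - ‖b‖ ^ 2 +
        Real.sqrt ((1 - ‖a‖ ^ 2 + ‖b‖ ^ 2) ^ 2 - 4 * ‖b‖ ^ 2))) := by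
  have ha0 := norm_nonneg a
  obtain hb0 | hb0 := (norm_nonneg b).eq_or_lt
  -- For `b = 0` the quadratic degenerates. Here `s = 1` in the upper bound and `r = 0` in the lower
  -- bound both give `1`.
  · obtain ⟨C, hC, hle⟩ := exists_affine_compositionOperator_norm_le hσ one_pos
      (by rwa [one_mul]) (by rw [← hb0]; simp; nlinarith)
    have hge := le_norm_affine_compositionOperator_sq hσ hab hC le_rfl one_pos
    refine ⟨C, hC, ?_⟩
    have h1 : ‖C‖ = 1 := by
      rw [← hb0] at hle
      norm_num at hle hge
      exact le_antisymm hle hge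
    have h2 : Real.sqrt ((1 - ‖a‖ ^ 2 + 0 ^ 2) ^ 2 - 4 * 0 ^ 2) = 1 - ‖a‖ ^ 2 := by
      rw [show (1 - ‖a‖ ^ 2 + 0 ^ 2) ^ 2 - 4 * 0 ^ 2 = (1 - ‖a‖ ^ 2) ^ 2 by ring]
      exact Real.sqrt_sq (by nlinarith)
    rw [← hb0, h2, show 1 + ‖a‖ ^ 2 - 0 ^ 2 + (1 - ‖a‖ ^ 2) = 2 by ring, div_self two_ne_zero,
      Real.sqrt_one, h1]
  · obtain ⟨s, hs0, hs1, hsL, hfix⟩ := exists_affine_fixedPoint hb0 hab ha0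
    have hsb : s * ‖b‖ < 1 := by nlinarith
    have hL : 0 < 1 - s * ‖b‖ := by linarith
    have hfix' : s * ‖a‖ / (1 - s * ‖b‖) * ‖a‖ + ‖b‖ = s := by
      field_simp
      linarith
    obtain ⟨C, hC, hle⟩ := exists_affine_compositionOperator_norm_le hσ hs0 hsb hfix'.le
    refine ⟨C, hC, ?_⟩
    have hinv : 2 / (1 + ‖a‖ ^ 2 - ‖b‖ ^ 2 +
        Real.sqrt ((1 - ‖a‖ ^ 2 + ‖b‖ ^ 2) ^ 2 - 4 * ‖b‖ ^ 2)) = (1 - s * ‖b‖)⁻¹ := by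
      rw [hsL, inv_div]
    rw [hinv, ← Real.sqrt_sq (norm_nonneg C)]
    congr 1
    refine le_antisymm hle ?_
    obtain hs1 | rfl := hs1.lt_or_eq
    · refine le_of_eq_of_le ?_ (le_norm_affine_compositionOperator_sq hσ hab hC hs0.le hs1)
      -- The fixed-point equation cancels `1 - s²` from the lower bound at `r = s`, leaving exactly
      -- the upper bound.
      have h1 : (1 - s * ‖b‖) ^ 2 - (s * ‖a‖) ^ 2 = (1 - s * ‖b‖) * (1 - s ^ 2) := by
        linear_combination s * hfix
      have h2 : 1 - s ^ 2 ≠ 0 := by nlinarith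
      rw [h1]
      field_simp
    -- `s = 1` is the boundary case `‖a‖ + ‖b‖ = 1`. The geometric series with `r = 1` is not in
    -- `H²`, so the lower bound is taken along `r → 1` after cancelling `1 - r`.
    · have hA : ‖a‖ = 1 - ‖b‖ := by
        have h1 : ‖a‖ ^ 2 = (1 - ‖b‖) ^ 2 := by linarith
        exact (pow_left_inj₀ ha0 (by linarith) two_ne_zero).1 h1
      have hlim : Tendsto (fun r : ℝ => (1 + r) / (1 - r * ‖b‖ + r * ‖a‖)) (𝓝[<] 1)
          (𝓝 ((1 + 1) / (1 - 1 * ‖b‖ + 1 * ‖a‖))) := by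
        have hc : ContinuousAt (fun r : ℝ => (1 + r) / (1 - r * ‖b‖ + r * ‖a‖)) 1 :=
          ContinuousAt.div (by fun_prop) (by fun_prop) (by linarith)
        exact hc.tendsto.mono_left nhdsWithin_le_nhds
      have hval : (1 + 1) / (1 - 1 * ‖b‖ + 1 * ‖a‖) = (1 - 1 * ‖b‖)⁻¹ := by
        rw [hA]
        field_simp
      rw [← hval]
      refine le_of_tendsto hlim ?_
      filter_upwards [Ioo_mem_nhdsLT (zero_lt_one' ℝ)] with r hr
      refine le_of_eq_of_le ?_ (le_norm_affine_compositionOperator_sq hσ hab hC hr.1.le hr.2)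
      have h1 : (1 - r * ‖b‖) ^ 2 - (r * ‖a‖) ^ 2 = (1 - r) * (1 - r * ‖b‖ + r * ‖a‖) := by
        rw [hA]; ring
      have h2 : 1 - r ≠ 0 := by linarith [hr.2]
      rw [h1, show 1 - r ^ 2 = (1 - r) * (1 + r) by ring, mul_div_mul_left _ _ h2]

end HardySpace

theorem mainTheorem6 (ψ : ℂ → ℂ) (hψ : IsInnerFunction ψ) (a b : ℂ)
    (hb : ‖b‖ < 1) (hab : ‖a‖ + ‖b‖ ≤ 1) :
    ∃ φ σ : 𝔻 → 𝔻,
      (∀ z : 𝔻, (φ z : ℂ) = a * z * ψ z + b) ∧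
      (∀ z : 𝔻, (σ z : ℂ) = a * z + b) ∧
      ∃ Cφ Cσ : HardySpace →L[ℂ] HardySpace,
        IsCompositionOperator φ Cφ ∧
        IsCompositionOperator σ Cσ ∧
        ‖Cφ‖ = Real.sqrt (2 / (1 + ‖a‖ ^ 2 - ‖b‖ ^ 2 +
          Real.sqrt ((1 - ‖a‖ ^ 2 + ‖b‖ ^ 2) ^ 2 - 4 * ‖b‖ ^ 2))) ∧
        ‖Cφ‖ = ‖Cσ‖ := by
  let σ : 𝔻 → 𝔻 := fun z => .mk (a * z + b) (norm_affine_add_lt_one hb hab z.norm_lt_one)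
  have hτ : ∀ z : 𝔻, ‖(z : ℂ) * ψ z‖ < 1 := fun z => by
    rw [norm_mul]
    exact (mul_le_of_le_one_right (norm_nonneg _) (hψ.norm_le_one z.norm_lt_one)).trans_lt
      z.norm_lt_one
  let τ : 𝔻 → 𝔻 := fun z => .mk (z * ψ z) (hτ z)
  have hσ : ∀ z : 𝔻, (σ z : ℂ) = a * z + b := fun _ => rfl
  obtain ⟨Cσ, hCσ, hnorm⟩ := HardySpace.exists_affine_compositionOperator_norm_eq hb hab hσ
  obtain ⟨Cτ, hCτ, hiso⟩ := hψ.id_mul.exists_isometric_compositionOperator (φ := τ)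
    (zero_mul _) fun _ => rfl
  -- Composition reverses the order: `f ∘ (σ ∘ τ) = Cτ (Cσ f)`. The isometry thus acts last and
  -- preserves the norm of every `Cσ f`.
  have heq : ‖Cτ ∘L Cσ‖ = ‖Cσ‖ :=
    ContinuousLinearMap.opNorm_ext _ _ fun f => hiso (Cσ f)
  refine ⟨σ ∘ τ, σ, fun z => ?_, hσ, Cτ ∘L Cσ, Cσ, fun f z => ?_, hCσ, heq.trans hnorm, heq⟩
  · rw [Function.comp_apply, hσ, mul_assoc]
    rfl
  · exact (hCτ (Cσ f) z).trans (hCσ f (τ z))
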